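/- Let $(T,\mu)$ be a $\sigma$-finite measure space with countably generated $\sigma$-algebra (for instance a Borel set $D\subseteq\mathbb{R}$ with Lebesgue measure), and let $\mathrm{L}^1=\mathrm{L}^1(T,\mu)$ be the (separable) space of real $\mu$-integrable functions with norm $\Vert h\Vert=\int_T|h|\,d\mu$. Let $\theta_0\in\mathrm{L}^1$. On a probability space $(\Omega,P)$ let, for each $n\ge 0$, $X_n$ be the observed sample (a random element of some measurable space), let $\hat\theta_n$ be an estimator of $\theta_0$, i.e. an $\mathrm{L}^1$-valued measurable function of $X_n$, and let $\hat\theta_n^*$ (the bootstrapped version of $\hat\theta_n$) be an $\mathrm{L}^1$-valued random element. Let $(r_n)$ and $(a_n)$ be real sequences with $r_n\to\infty$, $a_n\to 0$ and $a_nr_n\to\infty$. Assume that (i) $r_n(\hat\theta_n-\theta_0)$ converges weakly in $\mathrm{L}^1$ to a tight random element $\mathbb{G}_0$ of $\mathrm{L}^1$; (ii) the bootstrap process $r_n(\hat\theta_n^*-\hat\theta_n)$ is a.s. consistent in $\mathrm{L}^1$: almost surely, its conditional law given $X_n$ converges weakly in $\mathrm{L}^1$ to the law of $\mathbb{G}_0$.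 For $h\in\mathrm{L}^1$ put $$\hat\delta_n'(h)=\int_{\{|\hat\theta_n|\le a_n\}}|h|\,d\mu+\int_{\{|\hat\theta_n|>a_n\}}h\cdot\mathrm{sgn}(\hat\theta_n)\,d\mu,\qquad \delta'_{\theta_0}(h)=\int_{\{\theta_0=0\}}|h|\,d\mu+\int_{\{\theta_0\neq0\}}h\cdot\mathrm{sgn}(\theta_0)\,d\mu .$$ Then $\hat\delta_n'(r_n(\hat\theta_n^*-\hat\theta_n))$ is a (measurable) random variable for every $n$; the sequence $r_n(\Vert\hat\theta_n\Vert-\Vert\theta_0\Vert)$ converges in distribution to $\delta'_{\theta_0}(\mathbb{G}_0)$; and the conditional law of $\hat\delta_n'(r_n(\hat\theta_n^*-\hat\theta_n))$ given $X_n$ is a consistent estimator of this limit law, that is, $$\sup_{f}\Big|\mathrm{E}\big[f\big(\hat\delta_n'(r_n(\hat\theta_n^*-\hat\theta_n))\big)\,\big|\,X_n\big]-\mathrm{E}\big[f\big(\delta'_{\theta_0}(\mathbb{G}_0)\big)\big]\Big|\longrightarrow 0\quad\text{in probability},$$ where the supremum runs over all $f:\mathbb{R}\to\mathbb{R}$ with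 $|f|\le1$ and $|f(x)-f(y)|\le|x-y|$, and the conditional expectations are taken with respect to a regular conditional distribution. -/

import Mathlib

open MeasureTheory ProbabilityTheory Filter Topology
open scoped ENNReal

noncomputable section

/-- The Borel σ-algebra of `L¹(μ)`. -/
instance instMeasurableSpaceL1 {T : Type*} [MeasurableSpace T] {μ : Measure T} :
    MeasurableSpace (Lp ℝ 1 μ) := borel _

instance instBorelSpaceL1 {T : Type*} [MeasurableSpace T] {μ : Measure T} :
    BorelSpace (Lp ℝ 1 μ) := ⟨rfl⟩

/-- `L¹(μ)` is a Polish space when `μ` is σ-finite on a countably generated σ-algebra. -/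
instance instStandardBorelSpaceL1 {T : Type*} [MeasurableSpace T]
    [MeasurableSpace.CountablyGenerated T] {μ : Measure T} [SigmaFinite μ] :
    StandardBorelSpace (Lp ℝ 1 μ) := by
  have : Fact ((1 : ℝ≥0∞) ≠ ∞) := ⟨ENNReal.one_ne_top⟩
  have : SecondCountableTopology (Lp ℝ 1 μ) := inferInstance
  have : PolishSpace (Lp ℝ 1 μ) := inferInstance
  infer_instance

/-- Directional derivative of the `L¹`-norm at `θ` in the direction `h`:
`∫_{θ = 0} |h| + ∫_{θ ≠ 0} h · sgn θ`. -/
def l1NormDeriv {T : Type*} [MeasurableSpace T] {μ : Measure T} (θ h : Lp ℝ 1 μ) : ℝ :=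
  (∫ t in {t | θ t = 0}, |h t| ∂μ) + ∫ t in {t | θ t ≠ 0}, h t * Real.sign (θ t) ∂μ

/-- The same expression with the contact set enlarged to `{|θ| ≤ a}`:
`∫_{|θ| ≤ a} |h| + ∫_{|θ| > a} h · sgn θ`. -/
def l1NormDerivEnlarged {T : Type*} [MeasurableSpace T] {μ : Measure T} (a : ℝ)
    (θ h : Lp ℝ 1 μ) : ℝ :=
  (∫ t in {t | |θ t| ≤ a}, |h t| ∂μ) + ∫ t in {t | a < |θ t|}, h t * Real.sign (θ t) ∂μ

/-- The conditional law of the random element `Y` given the observation `X`, evaluated at the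
outcome `ω` (a version of the regular conditional distribution of `Y` given `X`). -/
def condLaw {Ω 𝒮 E : Type*} [MeasurableSpace Ω] [MeasurableSpace 𝒮] [MeasurableSpace E]
    [StandardBorelSpace E] [Nonempty E] (Y : Ω → E) (X : Ω → 𝒮) (P : Measure Ω)
    [IsFiniteMeasure P] (ω : Ω) : ProbabilityMeasure E :=
  ⟨condDistrib Y X P (X ω), inferInstance⟩

/-- Functions `E → ℝ` that are bounded by `1` and `1`-Lipschitz. -/
abbrev BL1 (E : Type*) [PseudoEMetricSpace E] : Type _ :=
  {f : E → ℝ // LipschitzWith 1 f ∧ ∀ x, |f x| ≤ 1}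

/-- Bounded Lipschitz distance `sup_f |∫ f dα - ∫ f dβ|` between two Borel probability measures.
The supremum is over a nonempty family bounded by `2`. -/
def boundedLipschitzDist {E : Type*} [PseudoEMetricSpace E] [MeasurableSpace E]
    (α β : ProbabilityMeasure E) : ℝ :=
  ⨆ f : BL1 E, |(∫ x, f.1 x ∂(α : Measure E)) - ∫ x, f.1 x ∂(β : Measure E)|

/-- The law of a measurable random element. -/
def lawOf {Ω E : Type*} [MeasurableSpace Ω] [MeasurableSpace E] (P : Measure Ω)
    [IsProbabilityMeasure P] (Y : Ω → E) (hY : AEMeasurable Y P) : ProbabilityMeasure E :=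
  ⟨P.map Y, Measure.isProbabilityMeasure_map hY⟩

/-- Almost sure consistency: almost surely, the conditional law of `Y n` given the sample `X n`
converges weakly to `ν`. -/
def AsConsistent {Ω E : Type*} {𝒮 : ℕ → Type*} [MeasurableSpace Ω] [∀ n, MeasurableSpace (𝒮 n)]
    [TopologicalSpace E] [MeasurableSpace E] [OpensMeasurableSpace E] [StandardBorelSpace E]
    [Nonempty E] (P : Measure Ω) [IsFiniteMeasure P] (Y : ℕ → Ω → E) (X : ∀ n, Ω → 𝒮 n)
    (ν : ProbabilityMeasure E) : Prop :=
  ∀ᵐ ω ∂P, Tendsto (fun n => condLaw (Y n) (X n) P ω) atTop (𝓝 ν)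

/-- Consistency (in probability): the bounded Lipschitz distance between the conditional law of
`Y n` given the sample `X n` and `ν` tends to `0` in probability. -/
def ConsistentInProbability {Ω E : Type*} {𝒮 : ℕ → Type*} [MeasurableSpace Ω]
    [∀ n, MeasurableSpace (𝒮 n)] [PseudoEMetricSpace E] [MeasurableSpace E]
    [StandardBorelSpace E] [Nonempty E] (P : Measure Ω) [IsFiniteMeasure P]
    (Y : ℕ → Ω → E) (X : ∀ n, Ω → 𝒮 n) (ν : ProbabilityMeasure E) : Prop :=
  TendstoInMeasure P (fun n ω => boundedLipschitzDist (condLaw (Y n) (X n) P ω) ν) atTop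
    (fun _ => (0 : ℝ))

end

/-! ### Weak convergence and the bounded Lipschitz distance. -/

section BoundedLipschitz

/-! The difference quotients of `|·|` converge pointwise and are dominated by `|h|`, so the
`L¹`-norm is directionally differentiable. Its difference quotients are also 1-Lipschitz in `h`, so
their error vanishes in probability when a weakly convergent sequence is inserted
(`tendstoInMeasure_comp_of_lipschitz`); Slutsky's lemma then gives the delta method.

For the bootstrap, freeze the sample. Whatever `a` and `θ`, the map `l1NormDerivEnlarged a θ` is
1-Lipschitz, so pushing forward along it does not increase the bounded Lipschitz distance. By
`boundedLipschitzDist_map_le`, the distance in question is at most that between the conditional law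
of the bootstrap process and the law `ν` of `G₀`, plus the `ν`-mean of the truncated difference
between the enlarged derivative at the estimator and the true derivative at `θ₀`. The first term
vanishes in probability by a.s. consistency. The second does because the estimation error divided by
`a n` tends to 0 in probability: along suitable subsequences, at almost every point, a zero of `θ₀`
eventually lies in the band `|θhat| ≤ a n`, while any other point eventually leaves it with the
correct sign (`tendsto_l1NormDerivEnlarged`). -/

instance {E : Type*} [PseudoEMetricSpace E] : Nonempty (BL1 E) :=
  ⟨⟨fun _ => 0, LipschitzWith.const 0 |>.weaken zero_le_one, by simp⟩⟩

section EMetric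

variable {E : Type*} [PseudoEMetricSpace E] [MeasurableSpace E]

theorem abs_integral_sub_integral_le_two (α β : ProbabilityMeasure E) (f : BL1 E) :
    |(∫ x, f.1 x ∂(α : Measure E)) - ∫ x, f.1 x ∂(β : Measure E)| ≤ 2 := by
  have key : ∀ γ : ProbabilityMeasure E, |∫ x, f.1 x ∂(γ : Measure E)| ≤ 1 := fun γ => by
    simpa using norm_integral_le_of_norm_le_const (μ := (γ : Measure E)) (f := f.1) (C := 1)
      (Eventually.of_forall f.2.2)
  calc _ ≤ |∫ x, f.1 x ∂(α : Measure E)| + |∫ x, f.1 x ∂(β : Measure E)| := norm_sub_le (E := ℝ) _ _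
    _ ≤ 2 := by linarith [key α, key β]

theorem bddAbove_boundedLipschitz (α β : ProbabilityMeasure E) :
    BddAbove (Set.range fun f : BL1 E =>
      |(∫ x, f.1 x ∂(α : Measure E)) - ∫ x, f.1 x ∂(β : Measure E)|) :=
  ⟨2, by rintro _ ⟨f, rfl⟩; exact abs_integral_sub_integral_le_two α β f⟩

theorem abs_integral_sub_le_boundedLipschitzDist (α β : ProbabilityMeasure E) {f : E → ℝ}
    (hf : LipschitzWith 1 f) (hb : ∀ x, |f x| ≤ 1) :
    |(∫ x, f x ∂(α : Measure E)) - ∫ x, f x ∂(β : Measure E)| ≤ boundedLipschitzDist α β :=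
  le_ciSup (bddAbove_boundedLipschitz α β) (⟨f, hf, hb⟩ : BL1 E)

theorem boundedLipschitzDist_le {α β : ProbabilityMeasure E} {c : ℝ}
    (h : ∀ f : E → ℝ, LipschitzWith 1 f → (∀ x, |f x| ≤ 1) →
      |(∫ x, f x ∂(α : Measure E)) - ∫ x, f x ∂(β : Measure E)| ≤ c) :
    boundedLipschitzDist α β ≤ c :=
  ciSup_le fun f => h f.1 f.2.1 f.2.2

theorem boundedLipschitzDist_nonneg (α β : ProbabilityMeasure E) :
    0 ≤ boundedLipschitzDist α β :=
  Real.iSup_nonneg fun _ => abs_nonneg _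

/-- Pushing forward along a `1`-Lipschitz map and changing that map for another one. -/
theorem boundedLipschitzDist_map_le [OpensMeasurableSpace E] {α ν : ProbabilityMeasure E}
    {φ ψ : E → ℝ} (hφ : LipschitzWith 1 φ) (hψ : Measurable ψ) {α' ν' : ProbabilityMeasure ℝ}
    (hα' : (α' : Measure ℝ) = (α : Measure E).map φ)
    (hν' : (ν' : Measure ℝ) = (ν : Measure E).map ψ) :
    boundedLipschitzDist α' ν' ≤
      boundedLipschitzDist α ν + ∫ x, min 2 |φ x - ψ x| ∂(ν : Measure E) := by
  refine boundedLipschitzDist_le fun f hf hb => ?_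
  have hφm : Measurable φ := hφ.continuous.measurable
  have hfm : Measurable f := hf.continuous.measurable
  rw [hα', hν', integral_map hφm.aemeasurable hfm.aestronglyMeasurable,
    integral_map hψ.aemeasurable hfm.aestronglyMeasurable]
  have h1 := abs_integral_sub_le_boundedLipschitzDist α ν (f := f ∘ φ)
    (by simpa using hf.comp hφ) (fun x => hb _)
  have hint : ∀ g : E → ℝ, Measurable g → Integrable (fun x => f (g x)) (ν : Measure E) :=
    fun g hg => Integrable.of_bound (hfm.comp hg).aestronglyMeasurable 1
      (Eventually.of_forall fun x => by simpa using hb _)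
  have h2 : |(∫ x, f (φ x) ∂(ν : Measure E)) - ∫ x, f (ψ x) ∂(ν : Measure E)| ≤
      ∫ x, min 2 |φ x - ψ x| ∂(ν : Measure E) := by
    rw [← integral_sub (hint φ hφm) (hint ψ hψ)]
    refine (abs_integral_le_integral_abs).trans (integral_mono ?_ ?_ fun x => ?_)
    · exact ((hint φ hφm).sub (hint ψ hψ)).abs
    · refine Integrable.of_bound (by fun_prop) 2 (Eventually.of_forall fun x => ?_)
      rw [Real.norm_eq_abs, abs_of_nonneg (le_min zero_le_two (abs_nonneg _))]
      exact min_le_left _ _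
    · refine le_min ?_ ?_
      · exact (norm_sub_le (f (φ x)) (f (ψ x))).trans (by simp only [Real.norm_eq_abs]; linarith [hb (φ x), hb (ψ x)])
      · simpa [Real.dist_eq] using hf.dist_le_mul (φ x) (ψ x)
  have h3 : (∫ x, (f ∘ φ) x ∂(α : Measure E)) = ∫ x, f (φ x) ∂(α : Measure E) := rfl
  have h4 : (∫ x, (f ∘ φ) x ∂(ν : Measure E)) = ∫ x, f (φ x) ∂(ν : Measure E) := rfl
  rw [h3, h4] at h1
  exact (abs_sub_le _ _ _).trans (add_le_add h1 h2)

end EMetric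

variable {E : Type*} [PseudoMetricSpace E] [MeasurableSpace E] [OpensMeasurableSpace E]

/-- A separable space splits into countably many continuity sets of small diameter. -/
theorem exists_null_frontier_partition [TopologicalSpace.SeparableSpace E] (ν : Measure E) [IsProbabilityMeasure ν]
    {ε : ℝ} (hε : 0 < ε) :
    ∃ A : ℕ → Set E, (∀ i, MeasurableSet (A i)) ∧ (∀ i, ν (frontier (A i)) = 0) ∧
      Pairwise (Function.onFun Disjoint A) ∧ (⋃ i, A i) = Set.univ ∧
      ∀ i, ∃ x, ∀ y ∈ A i, dist y x ≤ ε := by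
  have : Nonempty E := nonempty_of_isProbabilityMeasure ν
  -- Radii below `ε` keep the pieces small; radii above `ε / 2` let balls around a dense sequence
  -- cover the space.
  have hr : ∀ x : E, ∃ r ∈ Set.Ioo (ε / 2) ε, ν (frontier (Metric.ball x r)) = 0 := fun x => by
    simpa using exists_null_frontier_thickening ν {x} (half_lt_self hε)
  choose r hr hr0 using hr
  let x := TopologicalSpace.denseSeq E
  let B : ℕ → Set E := fun i => Metric.ball (x i) (r (x i))
  refine ⟨disjointed B, fun i => MeasurableSet.disjointed (fun i => measurableSet_ball) i,
    fun i => ?_, disjoint_disjointed B, ?_, fun i => ⟨x i, fun y hy => ?_⟩⟩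
  · refine disjointedRec (p := fun s => ν (frontier s) = 0) (fun t j ht => ?_) (hr0 (x i))
    rw [Set.sdiff_eq]
    refine null_frontier_inter ht ?_
    rw [frontier_compl]; exact hr0 (x j)
  · rw [iUnion_disjointed]
    refine Set.eq_univ_of_forall fun y => ?_
    obtain ⟨i, hi⟩ := (TopologicalSpace.denseRange_denseSeq E).exists_dist_lt y (half_pos hε)
    exact Set.mem_iUnion.2 ⟨i, Metric.mem_ball.2 (hi.trans (hr (x i)).1)⟩
  · have : y ∈ B i := disjointed_subset B i hy
    exact (Metric.mem_ball.1 this).le.trans (hr (x i)).2.le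

/-- The bounded Lipschitz distance to `ν` is controlled by finitely many continuity sets. -/
theorem exists_boundedLipschitzDist_le [TopologicalSpace.SeparableSpace E] (ν : ProbabilityMeasure E)
    {ε : ℝ} (hε : 0 < ε) :
    ∃ (N : ℕ) (A : ℕ → Set E), (∀ i, MeasurableSet (A i)) ∧
      (∀ i, (ν : Measure E) (frontier (A i)) = 0) ∧
      ∀ α : ProbabilityMeasure E, boundedLipschitzDist α ν ≤
        ε + 2 * ∑ i ∈ Finset.range N, |(α : Measure E).real (A i) - (ν : Measure E).real (A i)| := by
  obtain ⟨A, hAm, hA0, hAd, hAu, hAx⟩ :=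
    exists_null_frontier_partition (ν : Measure E) (show 0 < ε / 4 by positivity)
  choose x hx using hAx
  -- The mass outside the first `n` pieces; under `ν` it is small for large `n`.
  let C : ℕ → Set E := fun n => (⋃ i ∈ Finset.range n, A i)ᶜ
  have hCm : ∀ n, MeasurableSet (C n) := fun n =>
    (Finset.measurableSet_biUnion _ fun i _ => hAm i).compl
  have hsum : ∀ (α : ProbabilityMeasure E) n,
      (α : Measure E).real (C n) = 1 - ∑ i ∈ Finset.range n, (α : Measure E).real (A i) := by
    intro α n
    rw [probReal_compl_eq_one_sub (Finset.measurableSet_biUnion _ fun i _ => hAm i),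
      measureReal_biUnion_finset (fun i _ j _ hij => hAd hij) (fun i _ => hAm i)]
  have hlim : Tendsto (fun n => (ν : Measure E).real (C n)) atTop (𝓝 0) := by
    have h1 : HasSum (fun i => (ν : Measure E).real (A i)) 1 := by
      have h := measure_iUnion (μ := (ν : Measure E)) hAd hAm
      rw [hAu, measure_univ] at h
      have h' := ENNReal.hasSum_toReal (h ▸ ENNReal.one_ne_top)
      rwa [← ENNReal.tsum_toReal_eq (fun i => measure_ne_top _ _), ← h,
        ENNReal.toReal_one] at h'
    simp_rw [hsum ν]
    simpa using h1.tendsto_sum_nat.const_sub 1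
  obtain ⟨N, hN⟩ := (hlim.eventually (gt_mem_nhds (show 0 < ε / 4 by positivity))).exists
  refine ⟨N, A, hAm, hA0, fun α => boundedLipschitzDist_le fun f hf hb => ?_⟩
  have hfm : Measurable f := hf.continuous.measurable
  -- On each retained piece `f` is replaced by its value at the centre, with error at most `ε / 4`
  -- by the Lipschitz bound.
  let s : E → ℝ := fun y => ∑ i ∈ Finset.range N, (A i).indicator (fun _ => f (x i)) y
  have hint : ∀ γ : ProbabilityMeasure E, Integrable f (γ : Measure E) := fun γ =>
    Integrable.of_bound hfm.aestronglyMeasurable 1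
      (Eventually.of_forall fun x => by simpa using hb _)
  have hsint : ∀ γ : ProbabilityMeasure E, Integrable s (γ : Measure E) := fun γ =>
    integrable_finsetSum _ fun i _ => (integrable_const _).indicator (hAm i)
  have hs : ∀ γ : ProbabilityMeasure E, ∫ y, s y ∂(γ : Measure E) =
      ∑ i ∈ Finset.range N, (γ : Measure E).real (A i) * f (x i) := fun γ => by
    simp only [s]
    rw [integral_finsetSum _ fun i _ => (integrable_const _).indicator (hAm i)]
    refine Finset.sum_congr rfl fun i _ => ?_
    rw [integral_indicator_const _ (hAm i), smul_eq_mul]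
  have hfs : ∀ y, |f y - s y| ≤ ε / 4 + (C N).indicator (fun _ => (1 : ℝ)) y := by
    intro y
    by_cases hy : y ∈ C N
    · have : s y = 0 := Finset.sum_eq_zero fun i hi => Set.indicator_of_notMem
        (fun hyi => hy (Set.mem_biUnion (Finset.mem_coe.2 hi) hyi)) _
      rw [this, Set.indicator_of_mem hy, sub_zero]
      linarith [hb y]
    · rw [Set.indicator_of_notMem hy]
      obtain ⟨i, hi, hyi⟩ : ∃ i ∈ Finset.range N, y ∈ A i := by simpa [C] using hy
      have : s y = f (x i) := by
        simp only [s]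
        rw [Finset.sum_eq_single_of_mem i hi, Set.indicator_of_mem hyi]
        intro j _ hj
        exact Set.indicator_of_notMem (fun hyj => Set.disjoint_left.1 (hAd hj) hyj hyi) _
      rw [this, add_zero]
      have h := hf.dist_le_mul y (x i)
      simp only [NNReal.coe_one, one_mul, Real.dist_eq] at h
      exact h.trans (hx i y hyi)
  have hd : ∀ γ : ProbabilityMeasure E,
      |(∫ y, f y ∂(γ : Measure E)) - ∫ y, s y ∂(γ : Measure E)| ≤
        ε / 4 + (γ : Measure E).real (C N) := fun γ => by
    rw [← integral_sub (hint γ) (hsint γ)]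
    refine (abs_integral_le_integral_abs).trans ((integral_mono ((hint γ).sub (hsint γ)).abs
      ((integrable_const _).add ((integrable_const _).indicator (hCm N))) hfs).trans_eq ?_)
    rw [integral_add' (integrable_const _) ((integrable_const _).indicator (hCm N)),
      integral_indicator_const _ (hCm N)]
    simp
  have hss : |(∫ y, s y ∂(α : Measure E)) - ∫ y, s y ∂(ν : Measure E)| ≤
      ∑ i ∈ Finset.range N, |(α : Measure E).real (A i) - (ν : Measure E).real (A i)| := by
    rw [hs, hs, ← Finset.sum_sub_distrib]
    refine (Finset.abs_sum_le_sum_abs _ _).trans (Finset.sum_le_sum fun i _ => ?_)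
    rw [← sub_mul, abs_mul]
    exact mul_le_of_le_one_right (abs_nonneg _) (hb _)
  -- Total mass 1 transfers smallness of the leftover from `ν` to `α`. The errors then add up to `ε
  -- / 2 + 2 ν(C N)` plus twice the sum, whence the factor 2.
  have hC : (α : Measure E).real (C N) ≤ (ν : Measure E).real (C N) +
      ∑ i ∈ Finset.range N, |(α : Measure E).real (A i) - (ν : Measure E).real (A i)| := by
    rw [hsum, hsum]
    have : ∑ i ∈ Finset.range N, ((ν : Measure E).real (A i) - (α : Measure E).real (A i)) ≤
        ∑ i ∈ Finset.range N, |(α : Measure E).real (A i) - (ν : Measure E).real (A i)| :=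
      Finset.sum_le_sum fun i _ => by rw [abs_sub_comm]; exact le_abs_self _
    rw [Finset.sum_sub_distrib] at this
    linarith
  have h1 := abs_le.1 (hd α)
  have h2 := abs_le.1 (hd ν)
  have h3 := abs_le.1 hss
  rw [abs_le]
  constructor <;> linarith

theorem tendsto_measureReal_of_null_frontier {ι : Type*} {l : Filter ι}
    {α : ι → ProbabilityMeasure E} {ν : ProbabilityMeasure E} (h : Tendsto α l (𝓝 ν))
    {A : Set E} (hA : (ν : Measure E) (frontier A) = 0) :
    Tendsto (fun i => (α i : Measure E).real A) l (𝓝 ((ν : Measure E).real A)) :=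
  (ENNReal.tendsto_toReal (measure_ne_top _ _)).comp
    (ProbabilityMeasure.tendsto_measure_of_null_frontier_of_tendsto' h hA)

theorem tendsto_sum_abs_measureReal_sub {ι : Type*} {l : Filter ι}
    {α : ι → ProbabilityMeasure E} {ν : ProbabilityMeasure E} (h : Tendsto α l (𝓝 ν))
    {A : ℕ → Set E} (hA : ∀ i, (ν : Measure E) (frontier (A i)) = 0) (N : ℕ) :
    Tendsto (fun k => ∑ i ∈ Finset.range N,
      |(α k : Measure E).real (A i) - (ν : Measure E).real (A i)|) l (𝓝 0) := by
  have : ∀ i ∈ Finset.range N, Tendsto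
      (fun k => |(α k : Measure E).real (A i) - (ν : Measure E).real (A i)|) l (𝓝 0) :=
    fun i _ => by
      simpa using ((tendsto_measureReal_of_null_frontier h (hA i)).sub_const
        ((ν : Measure E).real (A i))).abs
  simpa using tendsto_finsetSum _ this

/-- Weak convergence implies convergence in the bounded Lipschitz distance. -/
theorem tendsto_boundedLipschitzDist [TopologicalSpace.SeparableSpace E] {ι : Type*} {l : Filter ι}
    {α : ι → ProbabilityMeasure E} {ν : ProbabilityMeasure E} (h : Tendsto α l (𝓝 ν)) :
    Tendsto (fun i => boundedLipschitzDist (α i) ν) l (𝓝 0) := by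
  rw [Metric.tendsto_nhds]
  intro ε hε
  obtain ⟨N, A, -, hA0, hle⟩ := exists_boundedLipschitzDist_le ν (half_pos hε)
  filter_upwards [(tendsto_sum_abs_measureReal_sub h hA0 N).eventually
    (gt_mem_nhds (show 0 < ε / 4 by positivity))] with i hi
  rw [Real.dist_eq, sub_zero, abs_of_nonneg (boundedLipschitzDist_nonneg _ _)]
  linarith [hle (α i)]

/-- Almost sure weak convergence of random measures implies convergence in probability in the
bounded Lipschitz distance. -/
theorem tendstoInMeasure_boundedLipschitzDist [TopologicalSpace.SeparableSpace E] {Ω : Type*}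
    [MeasurableSpace Ω] {P : Measure Ω} [IsFiniteMeasure P] {κ : ℕ → Ω → ProbabilityMeasure E}
    {ν : ProbabilityMeasure E}
    (hκ : ∀ n, ∀ A : Set E, MeasurableSet A → Measurable fun ω => (κ n ω : Measure E) A)
    (h : ∀ᵐ ω ∂P, Tendsto (fun n => κ n ω) atTop (𝓝 ν)) :
    TendstoInMeasure P (fun n ω => boundedLipschitzDist (κ n ω) ν) atTop fun _ => (0 : ℝ) := by
  rw [tendstoInMeasure_iff_norm]
  intro ε hε
  obtain ⟨N, A, hAm, hA0, hle⟩ := exists_boundedLipschitzDist_le ν (half_pos hε)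
  -- The supremum over `f` need not be known to be measurable in `ω`. The finite sum bounding it is,
  -- so a.s. convergence gives convergence in probability for that sum.
  have hS : TendstoInMeasure P (fun n ω => ∑ i ∈ Finset.range N,
      |(κ n ω : Measure E).real (A i) - (ν : Measure E).real (A i)|) atTop fun _ => (0 : ℝ) := by
    refine tendstoInMeasure_of_tendsto_ae (fun n => Measurable.aestronglyMeasurable ?_) ?_
    · exact Finset.measurable_fun_sum _ fun i _ =>
        ((hκ n _ (hAm i)).ennreal_toReal.sub_const _).abs
    · filter_upwards [h] with ω hω using tendsto_sum_abs_measureReal_sub hω hA0 N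
  rw [tendstoInMeasure_iff_norm] at hS
  refine tendsto_of_tendsto_of_tendsto_of_le_of_le tendsto_const_nhds
    (hS (ε / 4) (by positivity)) (fun _ => zero_le) fun n => measure_mono fun ω hω => ?_
  simp only [Set.mem_ofPred_eq, sub_zero, Real.norm_eq_abs] at hω ⊢
  rw [abs_of_nonneg (boundedLipschitzDist_nonneg _ _)] at hω
  refine le_trans ?_ (le_abs_self _)
  linarith [hle (κ n ω)]

end BoundedLipschitz

/-! ### The norm derivative: Lipschitz bounds and joint measurability. -/

section NormDerivative

/-- Pointwise integrand of `l1NormDerivEnlarged`. -/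
noncomputable def signDeriv (a x y : ℝ) : ℝ := if |x| ≤ a then |y| else y * Real.sign x

theorem abs_mul_sign_le (x y : ℝ) : |y * Real.sign x| ≤ |y| := by
  rcases Real.sign_apply_eq x with h | h | h <;> simp [h]

theorem abs_signDeriv_le (a x y : ℝ) : |signDeriv a x y| ≤ |y| := by
  unfold signDeriv
  split_ifs
  · simp
  · exact abs_mul_sign_le x y

theorem abs_signDeriv_sub_le (a x y z : ℝ) : |signDeriv a x y - signDeriv a x z| ≤ |y - z| := by
  unfold signDeriv
  split_ifs
  · exact abs_abs_sub_abs_le y z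
  · rw [← sub_mul]; exact abs_mul_sign_le x (y - z)

theorem measurable_sign_real : Measurable Real.sign := by
  unfold Real.sign
  exact Measurable.ite measurableSet_Iio measurable_const
    (Measurable.ite measurableSet_Ioi measurable_const measurable_const)

theorem measurable_signDeriv (a : ℝ) : Measurable fun p : ℝ × ℝ => signDeriv a p.1 p.2 := by
  unfold signDeriv
  exact Measurable.ite (measurableSet_le (by fun_prop) (by fun_prop)) (by fun_prop)
    (measurable_snd.mul (measurable_sign_real.comp measurable_fst))

variable {T : Type*} [MeasurableSpace T] {μ : Measure T}

theorem measurable_coeFn_Lp (θ : Lp ℝ 1 μ) : Measurable θ := (Lp.stronglyMeasurable θ).measurable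

theorem integrable_signDeriv (a : ℝ) (θ h : Lp ℝ 1 μ) :
    Integrable (fun t => signDeriv a (θ t) (h t)) μ :=
  (L1.integrable_coeFn h).mono
    ((measurable_signDeriv a).comp
      ((measurable_coeFn_Lp θ).prodMk (measurable_coeFn_Lp h))).aestronglyMeasurable
    (Eventually.of_forall fun t => by simpa using abs_signDeriv_le a (θ t) (h t))

theorem l1NormDerivEnlarged_eq_integral (a : ℝ) (θ h : Lp ℝ 1 μ) :
    l1NormDerivEnlarged a θ h = ∫ t, signDeriv a (θ t) (h t) ∂μ := by
  have hm : MeasurableSet {t | |θ t| ≤ a} :=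
    measurableSet_le (measurable_coeFn_Lp θ).abs measurable_const
  have hc : {t | a < |θ t|} = {t | |θ t| ≤ a}ᶜ := by ext t; simp
  rw [← integral_add_compl hm (integrable_signDeriv a θ h), l1NormDerivEnlarged, hc]
  congr 1
  · exact setIntegral_congr_fun hm fun t ht => by
      simp only [Set.mem_ofPred_eq] at ht; simp [signDeriv, ht]
  · exact setIntegral_congr_fun hm.compl fun t ht => by
      simp only [Set.mem_compl_iff, Set.mem_ofPred_eq] at ht
      simp only [signDeriv, ht, if_false]

theorem l1NormDeriv_eq_l1NormDerivEnlarged (θ h : Lp ℝ 1 μ) :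
    l1NormDeriv θ h = l1NormDerivEnlarged 0 θ h := by
  simp [l1NormDeriv, l1NormDerivEnlarged]

/-- Both branches of the integrand are 1-Lipschitz in the direction. The constant depends neither on
`a` nor on `θ`, which allows the estimator to be random. -/
theorem lipschitzWith_l1NormDerivEnlarged (a : ℝ) (θ : Lp ℝ 1 μ) :
    LipschitzWith 1 (l1NormDerivEnlarged a θ) := by
  refine LipschitzWith.of_dist_le_mul fun g h => ?_
  rw [NNReal.coe_one, one_mul, Real.dist_eq, l1NormDerivEnlarged_eq_integral,
    l1NormDerivEnlarged_eq_integral,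
    ← integral_sub (integrable_signDeriv a θ g) (integrable_signDeriv a θ h), dist_eq_norm,
    L1.norm_eq_integral_norm]
  refine abs_integral_le_integral_abs.trans (integral_mono_ae
    ((integrable_signDeriv a θ g).sub (integrable_signDeriv a θ h)).abs
    (L1.integrable_coeFn _).norm ?_)
  filter_upwards [Lp.coeFn_sub g h] with t ht
  rw [ht]
  exact abs_signDeriv_sub_le a (θ t) (g t) (h t)

theorem lipschitzWith_l1NormDeriv (θ : Lp ℝ 1 μ) : LipschitzWith 1 (l1NormDeriv θ) := by
  have : l1NormDeriv θ = l1NormDerivEnlarged 0 θ :=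
    funext fun h => l1NormDeriv_eq_l1NormDerivEnlarged θ h
  rw [this]
  exact lipschitzWith_l1NormDerivEnlarged 0 θ

/-- Continuity in `L¹` of an integral functional with continuous, dominated integrand. -/
theorem continuous_integral_comp_Lp {φ : ℝ → ℝ → ℝ} (hφ : Measurable fun p : ℝ × ℝ => φ p.1 p.2)
    (hc : ∀ y, Continuous fun x => φ x y) {C : ℝ} (hb : ∀ x y, |φ x y| ≤ C * |y|)
    (h : Lp ℝ 1 μ) : Continuous fun θ : Lp ℝ 1 μ => ∫ t, φ (θ t) (h t) ∂μ := by
  refine continuous_iff_seqContinuous.2 fun θ θ₀ hθ => tendsto_of_subseq_tendsto fun ns hns => ?_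
  obtain ⟨ms, -, hms⟩ := (tendstoInMeasure_of_tendsto_Lp (hθ.comp hns)).exists_seq_tendsto_ae
  refine ⟨ms, tendsto_integral_of_dominated_convergence (fun t => C * |h t|) (fun n => ?_)
    ((L1.integrable_coeFn h).abs.const_mul C)
    (fun n => Eventually.of_forall fun t => by simpa using hb _ _) ?_⟩
  · exact (hφ.comp ((measurable_coeFn_Lp _).prodMk (measurable_coeFn_Lp h))).aestronglyMeasurable
  · filter_upwards [hms] with t ht
    exact ((hc (h t)).tendsto _).comp ht

/-- Continuous approximations of `x ↦ signDeriv a x y`. -/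
noncomputable def signDerivApprox (a : ℝ) (k : ℕ) (x y : ℝ) : ℝ :=
  -- The first ramp vanishes on `|x| ≤ a` and tends to 1 elsewhere; the truncated line `k * x` tends
  -- to the sign.
  |y| + min 1 (k * max 0 (|x| - a)) * (y * max (-1) (min 1 (k * x)) - |y|)

theorem abs_signDerivApprox_le (a : ℝ) (k : ℕ) (x y : ℝ) :
    |signDerivApprox a k x y| ≤ 3 * |y| := by
  have h1 : |min 1 ((k : ℝ) * max 0 (|x| - a))| ≤ 1 := by
    rw [abs_of_nonneg (by positivity)]; exact min_le_left _ _
  have h2 : |max (-1) (min 1 ((k : ℝ) * x))| ≤ 1 :=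
    abs_le.2 ⟨le_max_left _ _, max_le (by norm_num) (min_le_left _ _)⟩
  have h3 : |(y * max (-1) (min 1 ((k : ℝ) * x)) - |y|)| ≤ 2 * |y| := by
    refine (norm_sub_le (E := ℝ) _ _).trans ?_
    simp only [Real.norm_eq_abs]
    rw [abs_mul, abs_abs]
    linarith [mul_le_of_le_one_right (abs_nonneg y) h2]
  unfold signDerivApprox
  refine (abs_add_le _ _).trans ?_
  rw [abs_abs, abs_mul]
  linarith [mul_le_of_le_one_left (abs_nonneg (y * max (-1) (min 1 ((k : ℝ) * x)) - |y|)) h1]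

theorem eventually_one_le_natCast_mul {x : ℝ} (hx : 0 < x) : ∀ᶠ k : ℕ in atTop, 1 ≤ (k : ℝ) * x :=
  (tendsto_natCast_atTop_atTop.atTop_mul_const hx).eventually_ge_atTop 1

theorem tendsto_signDerivApprox (a x y : ℝ) :
    Tendsto (fun k => signDerivApprox a k x y) atTop (𝓝 (signDeriv a x y)) := by
  by_cases hx : |x| ≤ a
  · refine tendsto_const_nhds.congr fun k => ?_
    simp [signDeriv, signDerivApprox, hx]
  · have hsign : ∀ᶠ k : ℕ in atTop, max (-1) (min 1 ((k : ℝ) * x)) = Real.sign x := by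
      rcases lt_trichotomy x 0 with h | h | h
      · filter_upwards [eventually_one_le_natCast_mul (neg_pos.2 h)] with k hk
        rw [Real.sign_of_neg h, min_eq_right (by linarith), max_eq_left (by linarith)]
      · exact Eventually.of_forall fun k => by simp [h]
      · filter_upwards [eventually_one_le_natCast_mul h] with k hk
        rw [Real.sign_of_pos h, min_eq_left hk, max_eq_right (by norm_num)]
    refine tendsto_const_nhds.congr' ?_
    filter_upwards [hsign, eventually_one_le_natCast_mul (sub_pos.2 (not_le.1 hx))] with k h1 h2
    rw [signDerivApprox, h1, max_eq_right (sub_pos.2 (not_le.1 hx)).le, min_eq_left h2]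
    simp [signDeriv, hx]

/-- The functional jumps in `θ`, at the edge of the band for instance, but it is a pointwise limit
of continuous functionals. -/
theorem measurable_l1NormDerivEnlarged_left (a : ℝ) (h : Lp ℝ 1 μ) :
    Measurable fun θ : Lp ℝ 1 μ => l1NormDerivEnlarged a θ h := by
  have hcont : ∀ k, Continuous fun p : ℝ × ℝ => signDerivApprox a k p.1 p.2 := fun k => by
    unfold signDerivApprox; fun_prop
  have hcont' : ∀ k, Continuous fun θ : Lp ℝ 1 μ => ∫ t, signDerivApprox a k (θ t) (h t) ∂μ :=
    fun k => continuous_integral_comp_Lp (hcont k).measurable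
      (fun y => (hcont k).comp (by fun_prop : Continuous fun x : ℝ => (x, y)))
      (abs_signDerivApprox_le a k) h
  refine measurable_of_tendsto_metrizable (fun k => (hcont' k).measurable)
    (tendsto_pi_nhds.2 fun θ => ?_)
  rw [l1NormDerivEnlarged_eq_integral]
  refine tendsto_integral_of_dominated_convergence (fun t => 3 * |h t|) (fun k => ?_)
    ((L1.integrable_coeFn h).abs.const_mul 3)
    (fun k => Eventually.of_forall fun t => by simpa using abs_signDerivApprox_le a k _ _)
    (Eventually.of_forall fun t => tendsto_signDerivApprox a _ _)
  exact ((hcont k).measurable.comp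
    ((measurable_coeFn_Lp θ).prodMk (measurable_coeFn_Lp h))).aestronglyMeasurable

theorem secondCountableTopology_Lp_one [MeasurableSpace.CountablyGenerated T] [SigmaFinite μ] :
    SecondCountableTopology (Lp ℝ 1 μ) :=
  have : Fact ((1 : ℝ≥0∞) ≠ ∞) := ⟨ENNReal.one_ne_top⟩
  inferInstance

/-- A Carathéodory argument: continuous in the direction, measurable in `θ`, on a separable space.
-/
theorem measurable_l1NormDerivEnlarged [MeasurableSpace.CountablyGenerated T] [SigmaFinite μ]
    (a : ℝ) : Measurable fun p : Lp ℝ 1 μ × Lp ℝ 1 μ => l1NormDerivEnlarged a p.1 p.2 := by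
  have := secondCountableTopology_Lp_one (μ := μ)
  exact (measurable_uncurry_of_continuous_of_measurable
    (u := fun h θ : Lp ℝ 1 μ => l1NormDerivEnlarged a θ h)
    (fun θ => (lipschitzWith_l1NormDerivEnlarged a θ).continuous)
    (measurable_l1NormDerivEnlarged_left a)).comp measurable_swap

/-! ### Limits of enlarged derivatives and of difference quotients. -/

/-- The sequence is eventually constant. If `x₀ = 0`, the rate puts `x n` inside the band; otherwise
the band shrinks away from `x n`, whose sign has settled. -/
theorem tendsto_signDeriv {b x : ℕ → ℝ} {x₀ : ℝ} (y : ℝ) (hb : Tendsto b atTop (𝓝 0))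
    (hb0 : ∀ᶠ n in atTop, 0 < b n)
    (hx : Tendsto (fun n => (b n)⁻¹ * (x n - x₀)) atTop (𝓝 0)) :
    Tendsto (fun n => signDeriv (b n) (x n) y) atTop (𝓝 (signDeriv 0 x₀ y)) := by
  have hx' : Tendsto x atTop (𝓝 x₀) := by
    have h : Tendsto (fun n => b n * ((b n)⁻¹ * (x n - x₀)) + x₀) atTop (𝓝 x₀) := by
      simpa using (hb.mul hx).add_const x₀
    refine h.congr' ?_
    filter_upwards [hb0] with n hn
    field_simp
    ring
  refine tendsto_const_nhds.congr' ?_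
  by_cases h0 : x₀ = 0
  · subst h0
    filter_upwards [hb0, hx.abs.eventually (gt_mem_nhds (show |(0 : ℝ)| < 1 by simp))]
      with n hn h1
    have : |x n| ≤ b n := by
      rw [abs_mul, abs_inv, abs_of_pos hn, sub_zero, inv_mul_lt_one₀ hn] at h1
      exact h1.le
    simp [signDeriv, this]
  · have h1 : ∀ᶠ n in atTop, b n < |x n| := hb.eventually_lt hx'.abs (abs_pos.2 h0)
    have h2 : ∀ᶠ n in atTop, Real.sign (x n) = Real.sign x₀ := by
      rcases lt_or_gt_of_ne h0 with h | h
      · filter_upwards [hx'.eventually (gt_mem_nhds h)] with n hn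
        rw [Real.sign_of_neg h, Real.sign_of_neg hn]
      · filter_upwards [hx'.eventually (lt_mem_nhds h)] with n hn
        rw [Real.sign_of_pos h, Real.sign_of_pos hn]
    filter_upwards [h1, h2] with n hn hs
    simp [signDeriv, h0, hs, not_le.2 hn]

/-- The enlarged derivatives at `θ n` are consistent for the derivative at `θ₀` as soon as
`θ n` approaches `θ₀` faster than the enlargement `b n` vanishes. -/
theorem tendsto_l1NormDerivEnlarged {b : ℕ → ℝ} {θ : ℕ → Lp ℝ 1 μ} {θ₀ : Lp ℝ 1 μ}
    (h : Lp ℝ 1 μ) (hb : Tendsto b atTop (𝓝 0)) (hb0 : ∀ᶠ n in atTop, 0 < b n)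
    (hθ : Tendsto (fun n => (b n)⁻¹ * ‖θ n - θ₀‖) atTop (𝓝 0)) :
    Tendsto (fun n => l1NormDerivEnlarged (b n) (θ n) h) atTop (𝓝 (l1NormDeriv θ₀ h)) := by
  -- The rescaled differences, not just `θ n - θ₀`, vanish in `L¹`. An a.e. convergent subsequence
  -- thus provides the pointwise rate that `tendsto_signDeriv` needs at zeros of `θ₀`.
  have hL : Tendsto (fun n => (b n)⁻¹ • (θ n - θ₀)) atTop (𝓝 0) := by
    rw [tendsto_zero_iff_norm_tendsto_zero]
    refine hθ.congr' ?_
    filter_upwards [hb0] with n hn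
    rw [norm_smul, Real.norm_eq_abs, abs_of_pos (inv_pos.2 hn)]
  rw [l1NormDeriv_eq_l1NormDerivEnlarged]
  simp_rw [l1NormDerivEnlarged_eq_integral]
  refine tendsto_of_subseq_tendsto fun ns hns => ?_
  obtain ⟨ms, hmono, hms⟩ := (tendstoInMeasure_of_tendsto_Lp (hL.comp hns)).exists_seq_tendsto_ae
  have hnm : Tendsto (fun n => ns (ms n)) atTop atTop := hns.comp hmono.tendsto_atTop
  refine ⟨ms, tendsto_integral_of_dominated_convergence (fun t => |h t|)
    (fun n => (integrable_signDeriv _ _ h).1) (L1.integrable_coeFn h).abs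
    (fun n => Eventually.of_forall fun t => by simpa using abs_signDeriv_le _ _ _) ?_⟩
  have hcoe : ∀ᵐ t ∂μ, ∀ n, ((b n)⁻¹ • (θ n - θ₀) : Lp ℝ 1 μ) t = (b n)⁻¹ * (θ n t - θ₀ t) := by
    refine ae_all_iff.2 fun n => ?_
    filter_upwards [Lp.coeFn_smul (b n)⁻¹ (θ n - θ₀), Lp.coeFn_sub (θ n) θ₀] with t h1 h2
    rw [h1, Pi.smul_apply, h2, Pi.sub_apply, smul_eq_mul]
  filter_upwards [hms, hcoe, Lp.coeFn_zero ℝ 1 μ] with t ht hc h0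
  refine tendsto_signDeriv (h t) (hb.comp hnm) (hnm.eventually hb0) ?_
  simp only [Function.comp_apply, hc, h0, Pi.zero_apply] at ht
  exact ht

theorem abs_mul_abs_add_inv_mul_sub_le {r : ℝ} (hr : 0 < r) (x y : ℝ) :
    |r * (|x + r⁻¹ * y| - |x|)| ≤ |y| := by
  rw [abs_mul, abs_of_pos hr]
  calc r * |(|x + r⁻¹ * y| - |x|)| ≤ r * |x + r⁻¹ * y - x| :=
        mul_le_mul_of_nonneg_left (abs_abs_sub_abs_le _ _) hr.le
    _ = |y| := by
        rw [add_sub_cancel_left, abs_mul, abs_inv, abs_of_pos hr, mul_inv_cancel_left₀ hr.ne']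

theorem tendsto_mul_abs_add_inv_mul_sub {r : ℕ → ℝ} (hr : Tendsto r atTop atTop) (x y : ℝ) :
    Tendsto (fun n => r n * (|x + (r n)⁻¹ * y| - |x|)) atTop (𝓝 (signDeriv 0 x y)) := by
  have hpos := hr.eventually_gt_atTop 0
  refine tendsto_const_nhds.congr' ?_
  by_cases h0 : x = 0
  · filter_upwards [hpos] with n hn
    simp only [signDeriv, h0, abs_zero, le_refl, if_true, zero_add, sub_zero, abs_mul, abs_inv,
      abs_of_pos hn]
    rw [mul_inv_cancel_left₀ hn.ne']
  · have hx : Tendsto (fun n => x + (r n)⁻¹ * y) atTop (𝓝 x) := by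
      simpa using ((tendsto_inv_atTop_zero.comp hr).mul_const y).const_add x
    rcases lt_or_gt_of_ne h0 with h | h
    · filter_upwards [hpos, hx.eventually (gt_mem_nhds h)] with n hn h1
      rw [abs_of_neg h1, abs_of_neg h]
      simp only [signDeriv, abs_nonpos_iff, h0, if_false, Real.sign_of_neg h]
      field_simp
      ring
    · filter_upwards [hpos, hx.eventually (lt_mem_nhds h)] with n hn h1
      rw [abs_of_pos h1, abs_of_pos h]
      simp only [signDeriv, abs_nonpos_iff, h0, if_false, Real.sign_of_pos h]
      field_simp
      ring

/-- Directional differentiability of the `L¹`-norm. -/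
theorem tendsto_mul_norm_add_smul_sub {r : ℕ → ℝ} (hr : Tendsto r atTop atTop)
    (θ₀ h : Lp ℝ 1 μ) :
    Tendsto (fun n => r n * (‖θ₀ + (r n)⁻¹ • h‖ - ‖θ₀‖)) atTop (𝓝 (l1NormDeriv θ₀ h)) := by
  rw [l1NormDeriv_eq_l1NormDerivEnlarged, l1NormDerivEnlarged_eq_integral]
  have hcoe : ∀ n, ∀ᵐ t ∂μ, (θ₀ + (r n)⁻¹ • h : Lp ℝ 1 μ) t = θ₀ t + (r n)⁻¹ * h t := fun n => by
    filter_upwards [Lp.coeFn_add θ₀ ((r n)⁻¹ • h), Lp.coeFn_smul (r n)⁻¹ h] with t h1 h2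
    rw [h1, Pi.add_apply, h2, Pi.smul_apply, smul_eq_mul]
  have heq : ∀ n, r n * (‖θ₀ + (r n)⁻¹ • h‖ - ‖θ₀‖) =
      ∫ t, r n * (|θ₀ t + (r n)⁻¹ * h t| - |θ₀ t|) ∂μ := fun n => by
    rw [L1.norm_eq_integral_norm, L1.norm_eq_integral_norm,
      ← integral_sub (L1.integrable_coeFn _).norm (L1.integrable_coeFn _).norm,
      ← integral_const_mul]
    refine integral_congr_ae ?_
    filter_upwards [hcoe n] with t ht
    simp only [ht, Real.norm_eq_abs]
  simp_rw [heq]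
  have hθ₀ := measurable_coeFn_Lp θ₀
  have hh := measurable_coeFn_Lp h
  refine tendsto_integral_filter_of_dominated_convergence (fun t => |h t|)
    (Eventually.of_forall fun n => by fun_prop) ?_ (L1.integrable_coeFn h).abs
    (Eventually.of_forall fun t => tendsto_mul_abs_add_inv_mul_sub hr _ _)
  filter_upwards [hr.eventually_gt_atTop 0] with n hn
  exact Eventually.of_forall fun t => abs_mul_abs_add_inv_mul_sub_le hn _ _

theorem lipschitzWith_mul_norm_add_smul_sub {E : Type*} [NormedAddCommGroup E] [NormedSpace ℝ E]
    {r : ℝ} (hr : 0 < r) (x : E) :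
    LipschitzWith 1 fun h : E => r * (‖x + r⁻¹ • h‖ - ‖x‖) := by
  refine LipschitzWith.of_dist_le_mul fun g h => ?_
  rw [NNReal.coe_one, one_mul, Real.dist_eq, dist_eq_norm, ← mul_sub, sub_sub_sub_cancel_right,
    abs_mul, abs_of_pos hr]
  calc r * |‖x + r⁻¹ • g‖ - ‖x + r⁻¹ • h‖| ≤ r * ‖x + r⁻¹ • g - (x + r⁻¹ • h)‖ := by
        gcongr; exact abs_norm_sub_norm_le _ _
    _ = ‖g - h‖ := by
        rw [add_sub_add_left_eq_sub, ← smul_sub, norm_smul, Real.norm_eq_abs,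
          abs_of_pos (inv_pos.2 hr), mul_inv_cancel_left₀ hr.ne']

end NormDerivative

/-! ### Conditional laws and convergence in probability. -/

section Consistency

/-- A measurable function of `X` and `Y` has as conditional law given `X = x` the image of the
conditional law of `Y`, with `x` frozen. -/
theorem condDistrib_comp_prodMk {α β Ω Ω' : Type*} [MeasurableSpace α] [MeasurableSpace β]
    [MeasurableSpace Ω] [StandardBorelSpace Ω] [Nonempty Ω] [MeasurableSpace Ω']
    [StandardBorelSpace Ω'] [Nonempty Ω'] {μ : Measure α} [IsFiniteMeasure μ] {X : α → β}
    {Y : α → Ω} (hX : Measurable X) (hY : Measurable Y) {f : β × Ω → Ω'} (hf : Measurable f) :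
    ∀ᵐ x ∂μ.map X, condDistrib (fun a => f (X a, Y a)) X μ x =
      (condDistrib Y X μ x).map fun y => f (x, y) := by
  let κ : Kernel β Ω' := (Kernel.id ×ₖ condDistrib Y X μ).map f
  have hκ : ∀ x, κ x = (condDistrib Y X μ x).map fun y => f (x, y) := fun x => by
    simp only [κ]
    rw [Kernel.map_apply _ hf, Kernel.prod_apply, Kernel.id_apply, Measure.dirac_prod,
      Measure.map_map hf measurable_prodMk_left]
    rfl
  have : IsFiniteKernel κ := Kernel.IsFiniteKernel.map _ f
  -- A conditional law is determined a.e. by the joint law, so it suffices to compare joint laws.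
  have h := condDistrib_ae_eq_of_measure_eq_compProd (μ := μ) X
    (Y := fun a => f (X a, Y a)) (κ := κ) (hf.comp (hX.prodMk hY)).aemeasurable (by
      ext s hs
      have hg : Measurable fun p : β × Ω => (p.1, f p) := measurable_fst.prodMk hf
      have hXY : μ.map X ⊗ₘ condDistrib Y X μ = μ.map fun a => (X a, Y a) :=
        compProd_map_condDistrib hY.aemeasurable
      rw [Measure.compProd_apply hs, Measure.map_apply (by fun_prop) hs]
      have hL : (fun a => (X a, f (X a, Y a))) ⁻¹' s =
          (fun a => (X a, Y a)) ⁻¹' ((fun p : β × Ω => (p.1, f p)) ⁻¹' s) := rfl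
      rw [hL, ← Measure.map_apply (hX.prodMk hY) (hg hs), ← hXY,
        Measure.compProd_apply (hg hs)]
      refine lintegral_congr fun x => ?_
      have hfx : Measurable fun y => f (x, y) := hf.comp measurable_prodMk_left
      rw [hκ, Measure.map_apply hfx (measurable_prodMk_left hs)]
      rfl)
  filter_upwards [h] with x hx
  rw [hx, hκ]

/-- If `X n` converges in distribution and the equi-Lipschitz functions `f n` vanish pointwise in
the limit, then `f n (X n)` tends to zero in probability. -/
theorem tendstoInMeasure_comp_of_lipschitz {E Ω Ω' : Type*} [PseudoMetricSpace E]
    [TopologicalSpace.SeparableSpace E] [MeasurableSpace E] [BorelSpace E] [MeasurableSpace Ω]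
    {P : Measure Ω} [IsProbabilityMeasure P] [MeasurableSpace Ω'] {P' : Measure Ω'}
    [IsProbabilityMeasure P'] {X : ℕ → Ω → E} {G : Ω' → E}
    (hX : TendstoInDistribution X atTop G (fun _ => P) P') {f : ℕ → E → ℝ} {K : NNReal}
    (hK : 0 < K) (hf : ∀ᶠ n in atTop, LipschitzWith K (f n))
    (hlim : ∀ x, Tendsto (fun n => f n x) atTop (𝓝 0)) :
    TendstoInMeasure P (fun n ω => f n (X n ω)) atTop fun _ => (0 : ℝ) := by
  rw [tendstoInMeasure_iff_measureReal_norm]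
  intro ε hε
  -- Rescaling and truncation make `|f n|` a bounded Lipschitz test function; Markov's inequality at
  -- the transformed threshold `δ` then concludes.
  let g : ℕ → E → ℝ := fun n x => min 1 ((K : ℝ)⁻¹ * |f n x|)
  have hK' : (0 : ℝ) < K := hK
  have hg0 : ∀ n x, 0 ≤ g n x := fun n x => by positivity
  have hg1 : ∀ n x, |g n x| ≤ 1 := fun n x => by
    rw [abs_of_nonneg (hg0 n x)]; exact min_le_left _ _
  have hgL : ∀ᶠ n in atTop, LipschitzWith 1 (g n) := by
    filter_upwards [hf] with n hn
    refine LipschitzWith.of_dist_le_mul fun x y => ?_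
    rw [NNReal.coe_one, one_mul, Real.dist_eq]
    have h1 := abs_min_sub_min_le_max 1 ((K : ℝ)⁻¹ * |f n x|) 1 ((K : ℝ)⁻¹ * |f n y|)
    refine h1.trans (max_le (by simp) ?_)
    rw [← mul_sub, abs_mul, abs_inv, abs_of_pos hK', inv_mul_le_iff₀ hK']
    refine (abs_abs_sub_abs_le _ _).trans ?_
    simpa [Real.dist_eq] using hn.dist_le_mul x y
  let ν : ProbabilityMeasure E :=
    ⟨P'.map G, Measure.isProbabilityMeasure_map hX.aemeasurable_limit⟩
  let α : ℕ → ProbabilityMeasure E := fun n =>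
    ⟨P.map (X n), Measure.isProbabilityMeasure_map (hX.forall_aemeasurable n)⟩
  have hBL : Tendsto (fun n => boundedLipschitzDist (α n) ν) atTop (𝓝 0) :=
    tendsto_boundedLipschitzDist hX.tendsto
  have hgν : Tendsto (fun n => ∫ x, g n x ∂(ν : Measure E)) atTop (𝓝 0) := by
    have h := tendsto_integral_filter_of_dominated_convergence (μ := (ν : Measure E))
      (l := atTop) (F := g) (f := fun _ => (0 : ℝ)) (fun _ => 1)
      (by filter_upwards [hgL] with n hn using hn.continuous.measurable.aestronglyMeasurable)
      (Eventually.of_forall fun n => Eventually.of_forall (hg1 n)) (integrable_const _)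
      (Eventually.of_forall fun x => by
        simpa [g] using (tendsto_const_nhds (x := (1 : ℝ))).min ((hlim x).abs.const_mul (K : ℝ)⁻¹))
    simpa using h
  let δ : ℝ := min 1 ((K : ℝ)⁻¹ * ε)
  have hδ : 0 < δ := by positivity
  have hbound : Tendsto (fun n => δ⁻¹ * (boundedLipschitzDist (α n) ν +
      ∫ x, g n x ∂(ν : Measure E))) atTop (𝓝 0) := by
    simpa using (hBL.add hgν).const_mul δ⁻¹
  refine tendsto_of_tendsto_of_tendsto_of_le_of_le' tendsto_const_nhds hbound
    (Eventually.of_forall fun _ => measureReal_nonneg) ?_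
  filter_upwards [hgL] with n hn
  have hXn := hX.forall_aemeasurable n
  have hgm : Measurable (g n) := hn.continuous.measurable
  have h1 := abs_integral_sub_le_boundedLipschitzDist (α n) ν hn (hg1 n)
  have h2 : ∫ x, g n x ∂(α n : Measure E) = ∫ ω, g n (X n ω) ∂P :=
    integral_map hXn hgm.aestronglyMeasurable
  have hint : Integrable (fun ω => g n (X n ω)) P :=
    Integrable.of_bound (hgm.comp_aemeasurable hXn).aestronglyMeasurable 1
      (Eventually.of_forall fun ω => hg1 n _)
  have h3 := mul_meas_ge_le_integral_of_nonneg (μ := P) (f := fun ω => g n (X n ω))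
    (Eventually.of_forall fun ω => hg0 n _) hint δ
  have h4 : P.real {ω | ε ≤ ‖f n (X n ω) - 0‖} ≤ P.real {ω | δ ≤ g n (X n ω)} := by
    refine measureReal_mono fun ω hω => ?_
    simp only [Set.mem_ofPred_eq, sub_zero, Real.norm_eq_abs] at hω ⊢
    exact min_le_min_left _ (mul_le_mul_of_nonneg_left hω (by positivity))
  rw [inv_mul_eq_div, le_div_iff₀ hδ, mul_comm]
  have h5 := le_abs_self ((∫ x, g n x ∂(α n : Measure E)) - ∫ x, g n x ∂(ν : Measure E))
  have h6 := mul_le_mul_of_nonneg_left h4 hδ.le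
  linarith

/-- A nonnegative sequence below the sum of two sequences that vanish in probability. -/
theorem tendstoInMeasure_zero_of_le_add {Ω : Type*} [MeasurableSpace Ω] {P : Measure Ω}
    {f g h : ℕ → Ω → ℝ} (hf0 : ∀ n ω, 0 ≤ f n ω) (hle : ∀ n, ∀ᵐ ω ∂P, f n ω ≤ g n ω + h n ω)
    (hg : TendstoInMeasure P g atTop fun _ => (0 : ℝ))
    (hh : TendstoInMeasure P h atTop fun _ => (0 : ℝ)) :
    TendstoInMeasure P f atTop fun _ => (0 : ℝ) := by
  rw [tendstoInMeasure_iff_norm] at hg hh ⊢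
  intro ε hε
  have hsum := (hg (ε / 2) (half_pos hε)).add (hh (ε / 2) (half_pos hε))
  rw [add_zero] at hsum
  refine tendsto_of_tendsto_of_tendsto_of_le_of_le tendsto_const_nhds hsum
    (fun _ => zero_le) fun n => ?_
  refine (measure_mono_ae ?_).trans (measure_union_le _ _)
  filter_upwards [hle n] with ω hω hε'
  simp only [sub_zero, Real.norm_eq_abs] at hε' ⊢
  change ε ≤ _ at hε'
  rw [abs_of_nonneg (hf0 n ω)] at hε'
  by_contra hcon
  change ¬(ε / 2 ≤ |g n ω| ∨ ε / 2 ≤ |h n ω|) at hcon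
  rw [not_or] at hcon
  have h1 := lt_of_not_ge hcon.1
  have h2 := lt_of_not_ge hcon.2
  linarith [le_abs_self (g n ω), le_abs_self (h n ω)]

/-! ### Delta method and bootstrap consistency. -/

variable {T : Type*} [MeasurableSpace T] [MeasurableSpace.CountablyGenerated T]
  {μ : Measure T} [SigmaFinite μ] {Ω Ω' : Type*} [MeasurableSpace Ω] {P : Measure Ω}
  [IsProbabilityMeasure P] [MeasurableSpace Ω'] {P' : Measure Ω'} [IsProbabilityMeasure P']

/-- The delta method for the `L¹`-norm. -/
theorem tendstoInDistribution_mul_norm_sub {θ₀ : Lp ℝ 1 μ} {θ : ℕ → Ω → Lp ℝ 1 μ}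
    (hθ : ∀ n, Measurable (θ n)) {G : Ω' → Lp ℝ 1 μ} {r : ℕ → ℝ} (hr : Tendsto r atTop atTop)
    (hweak : TendstoInDistribution (fun n ω => r n • (θ n ω - θ₀)) atTop G (fun _ => P) P') :
    TendstoInDistribution (fun n ω => r n * (‖θ n ω‖ - ‖θ₀‖)) atTop
      (fun ω' => l1NormDeriv θ₀ (G ω')) (fun _ => P) P' := by
  have := secondCountableTopology_Lp_one (μ := μ)
  have hcont := (lipschitzWith_l1NormDeriv θ₀).continuous
  refine tendstoInDistribution_of_tendstoInMeasure_sub _ _ (hweak.continuous_comp hcont) ?_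
    fun n => ((hθ n).norm.sub_const _).const_mul _ |>.aemeasurable
  -- The error is a difference of two 1-Lipschitz functions, hence `K = 2`.
  have hφ := tendstoInMeasure_comp_of_lipschitz hweak (K := 2) two_pos
    (f := fun n h => r n * (‖θ₀ + (r n)⁻¹ • h‖ - ‖θ₀‖) - l1NormDeriv θ₀ h)
    (by
      filter_upwards [hr.eventually_gt_atTop 0] with n hn
      have h := (lipschitzWith_mul_norm_add_smul_sub hn θ₀).sub (lipschitzWith_l1NormDeriv θ₀)
      rwa [one_add_one_eq_two] at h)
    (fun h => by simpa using (tendsto_mul_norm_add_smul_sub hr θ₀ h).sub_const (l1NormDeriv θ₀ h))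
  refine hφ.congr' ?_ (Eventually.of_forall fun _ => rfl)
  filter_upwards [hr.eventually_gt_atTop 0] with n hn
  refine Eventually.of_forall fun ω => ?_
  simp [inv_smul_smul₀ hn.ne']

/-- An enlargement of order larger than `1 / r n` dominates the estimation error. -/
theorem tendstoInMeasure_inv_mul_norm_sub {θ₀ : Lp ℝ 1 μ} {θ : ℕ → Ω → Lp ℝ 1 μ}
    {G : Ω' → Lp ℝ 1 μ} {r a : ℕ → ℝ} (hr : Tendsto r atTop atTop)
    (har : Tendsto (fun n => a n * r n) atTop atTop)
    (hweak : TendstoInDistribution (fun n ω => r n • (θ n ω - θ₀)) atTop G (fun _ => P) P') :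
    TendstoInMeasure P (fun n ω => (a n)⁻¹ * ‖θ n ω - θ₀‖) atTop fun _ => (0 : ℝ) := by
  have := secondCountableTopology_Lp_one (μ := μ)
  have hinv : Tendsto (fun n => (a n * r n)⁻¹) atTop (𝓝 0) := tendsto_inv_atTop_zero.comp har
  have h := tendstoInMeasure_comp_of_lipschitz hweak (K := 1) one_pos
    (f := fun n h => (a n * r n)⁻¹ * ‖h‖)
    (by
      filter_upwards [har.eventually_ge_atTop 1] with n hn
      refine LipschitzWith.of_dist_le_mul fun x y => ?_
      rw [NNReal.coe_one, one_mul, Real.dist_eq, dist_eq_norm, ← mul_sub, abs_mul,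
        abs_of_pos (inv_pos.2 (one_pos.trans_le hn))]
      exact (mul_le_of_le_one_left (abs_nonneg _) (inv_le_one_of_one_le₀ hn)).trans
        (abs_norm_sub_norm_le x y))
    (fun h => by simpa using hinv.mul_const ‖h‖)
  refine h.congr' ?_ (Eventually.of_forall fun _ => rfl)
  filter_upwards [hr.eventually_gt_atTop 0] with n hn
  refine Eventually.of_forall fun ω => ?_
  simp only [norm_smul, Real.norm_eq_abs, abs_of_pos hn, mul_inv]
  rw [mul_assoc, inv_mul_cancel_left₀ hn.ne']

/-- The enlarged derivative at the estimator is consistent for the derivative at `θ₀`, in mean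
with respect to the direction. -/
theorem tendstoInMeasure_integral_min_abs_sub {θ₀ : Lp ℝ 1 μ} {θ : ℕ → Ω → Lp ℝ 1 μ}
    (hθ : ∀ n, Measurable (θ n)) {a : ℕ → ℝ} (ha : Tendsto a atTop (𝓝 0))
    (ha0 : ∀ᶠ n in atTop, 0 < a n) (ν : Measure (Lp ℝ 1 μ)) [IsProbabilityMeasure ν]
    (hθ₀ : TendstoInMeasure P (fun n ω => (a n)⁻¹ * ‖θ n ω - θ₀‖) atTop fun _ => (0 : ℝ)) :
    TendstoInMeasure P (fun n ω =>
      ∫ h, min 2 |l1NormDerivEnlarged (a n) (θ n ω) h - l1NormDeriv θ₀ h| ∂ν) atTop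
      fun _ => (0 : ℝ) := by
  have := secondCountableTopology_Lp_one (μ := μ)
  have hδ : Measurable (l1NormDeriv θ₀) := (lipschitzWith_l1NormDeriv θ₀).continuous.measurable
  have hm : ∀ n, Measurable fun p : Ω × Lp ℝ 1 μ =>
      min 2 |l1NormDerivEnlarged (a n) (θ n p.1) p.2 - l1NormDeriv θ₀ p.2| := fun n =>
    measurable_const.min (((measurable_l1NormDerivEnlarged (a n)).comp
      (((hθ n).comp measurable_fst).prodMk measurable_snd)).sub (hδ.comp measurable_snd)).abs
  -- Passing to a.s. convergent subsequences fixes `ω` and reduces the claim to the deterministic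
  -- limit under dominated convergence in `h`.
  refine (exists_seq_tendstoInMeasure_atTop_iff fun n =>
    ((hm n).stronglyMeasurable.integral_prod_right).aestronglyMeasurable).2 fun ns hns => ?_
  obtain ⟨ms, hms, hae⟩ := (hθ₀.comp hns.tendsto_atTop).exists_seq_tendsto_ae
  refine ⟨ms, hms, ?_⟩
  have hnm : Tendsto (fun i => ns (ms i)) atTop atTop := hns.tendsto_atTop.comp hms.tendsto_atTop
  filter_upwards [hae] with ω hω
  have h := tendsto_integral_of_dominated_convergence (μ := ν)
    (F := fun i h => min 2
      |l1NormDerivEnlarged (a (ns (ms i))) (θ (ns (ms i)) ω) h - l1NormDeriv θ₀ h|)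
    (f := fun _ => (0 : ℝ)) (fun _ => 2)
    (fun i => ((hm _).comp measurable_prodMk_left).aestronglyMeasurable) (integrable_const _)
    (fun i => Eventually.of_forall fun h => by
      rw [Real.norm_eq_abs, abs_of_nonneg (by positivity)]; exact min_le_left _ _)
    (Eventually.of_forall fun h => by
      have h1 := (tendsto_l1NormDerivEnlarged h (ha.comp hnm) (hnm.eventually ha0) hω).sub_const
        (l1NormDeriv θ₀ h)
      simpa using (tendsto_const_nhds (x := (2 : ℝ))).min h1.abs)
  simpa using h

end Consistency

theorem theorem3
    {T : Type*} [MeasurableSpace T] [MeasurableSpace.CountablyGenerated T]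
    (μ : Measure T) [SigmaFinite μ]
    {Ω : Type*} [MeasurableSpace Ω] (P : Measure Ω) [IsProbabilityMeasure P]
    {Ω' : Type*} [MeasurableSpace Ω'] (P' : Measure Ω') [IsProbabilityMeasure P']
    {𝒮 : ℕ → Type*} [∀ n, MeasurableSpace (𝒮 n)]
    (X : ∀ n, Ω → 𝒮 n) (hX : ∀ n, Measurable (X n))
    (θ₀ : Lp ℝ 1 μ)
    (θhat : ∀ n, 𝒮 n → Lp ℝ 1 μ) (hθhat : ∀ n, Measurable (θhat n))
    (θstar : ℕ → Ω → Lp ℝ 1 μ) (hθstar : ∀ n, Measurable (θstar n))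
    (G₀ : Ω' → Lp ℝ 1 μ) (hG₀ : Measurable G₀) (hG₀_tight : IsTightMeasureSet {P'.map G₀})
    (r a : ℕ → ℝ) (hr : Tendsto r atTop atTop)
    (ha : Tendsto a atTop (𝓝 0)) (har : Tendsto (fun n => a n * r n) atTop atTop)
    (hweak : TendstoInDistribution (fun n ω => r n • (θhat n (X n ω) - θ₀)) atTop G₀
      (fun _ => P) P')
    (hboot : AsConsistent P (fun n ω => r n • (θstar n ω - θhat n (X n ω))) X
      (lawOf P' G₀ hG₀.aemeasurable)) :
    (∀ n, Measurable fun ω =>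
      l1NormDerivEnlarged (a n) (θhat n (X n ω)) (r n • (θstar n ω - θhat n (X n ω)))) ∧
    TendstoInDistribution (fun n ω => r n * (‖θhat n (X n ω)‖ - ‖θ₀‖)) atTop
      (fun ω' => l1NormDeriv θ₀ (G₀ ω')) (fun _ => P) P' ∧
    ∃ hδ : AEMeasurable (fun ω' => l1NormDeriv θ₀ (G₀ ω')) P',
      ConsistentInProbability P
        (fun n ω =>
          l1NormDerivEnlarged (a n) (θhat n (X n ω)) (r n • (θstar n ω - θhat n (X n ω))))
        X (lawOf P' (fun ω' => l1NormDeriv θ₀ (G₀ ω')) hδ) := by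
  have := secondCountableTopology_Lp_one (μ := μ)
  have hθm : ∀ n, Measurable fun ω => θhat n (X n ω) := fun n => (hθhat n).comp (hX n)
  have hYm : ∀ n, Measurable fun ω => r n • (θstar n ω - θhat n (X n ω)) := fun n =>
    ((hθstar n).sub (hθm n)).const_smul (r n)
  have hδ : AEMeasurable (fun ω' => l1NormDeriv θ₀ (G₀ ω')) P' :=
    ((lipschitzWith_l1NormDeriv θ₀).continuous.measurable.comp hG₀).aemeasurable
  refine ⟨fun n => (measurable_l1NormDerivEnlarged (a n)).comp ((hθm n).prodMk (hYm n)),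
    tendstoInDistribution_mul_norm_sub hθm hr hweak, hδ, ?_⟩
  have ha0 : ∀ᶠ n in atTop, 0 < a n := by
    filter_upwards [hr.eventually_gt_atTop 0, har.eventually_gt_atTop 0] with n h1 h2
    exact pos_of_mul_pos_left h2 h1.le
  have : IsProbabilityMeasure (P'.map G₀) := Measure.isProbabilityMeasure_map hG₀.aemeasurable
  have hD := tendstoInMeasure_integral_min_abs_sub hθm ha ha0 (P'.map G₀)
    (tendstoInMeasure_inv_mul_norm_sub hr har hweak)
  have hB := tendstoInMeasure_boundedLipschitzDist (fun n A hA =>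
    (Kernel.measurable_coe (condDistrib (fun ω => r n • (θstar n ω - θhat n (X n ω))) (X n) P)
      hA).comp (hX n)) hboot
  refine tendstoInMeasure_zero_of_le_add (fun n ω => boundedLipschitzDist_nonneg _ _)
    (fun n => ?_) hB hD
  have hcond := condDistrib_comp_prodMk (μ := P) (hX n) (hYm n)
    (f := fun p : 𝒮 n × Lp ℝ 1 μ => l1NormDerivEnlarged (a n) (θhat n p.1) p.2)
    ((measurable_l1NormDerivEnlarged (a n)).comp
      (((hθhat n).comp measurable_fst).prodMk measurable_snd))
  -- For almost every `ω`, the conditional law is the image of that of the bootstrap process under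
  -- the map with the estimator frozen at `X n ω`.
  filter_upwards [ae_of_ae_map (hX n).aemeasurable hcond] with ω hω
  exact boundedLipschitzDist_map_le (lipschitzWith_l1NormDerivEnlarged (a n) _)
    (lipschitzWith_l1NormDeriv θ₀).continuous.measurable hω
    (Measure.map_map (lipschitzWith_l1NormDeriv θ₀).continuous.measurable hG₀).symm
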